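/- Let $q$ be an odd prime power and let $m \ge 2$ be an integer. A packing of order $v$ and block size $k$ is a set of $v$ points with a family of $k$-subsets (blocks) such that any two distinct points lie together in at most one block. It is maximum if no packing of order $v$ and block size $k$ has more blocks, cyclic if its point set is $\mathbb{Z}/v\mathbb{Z}$ and $B+1$ is a block for every block $B$, and $r$-even-free if for no $i$ with $1 \le i \le r$ there are $i$ distinct blocks such that every point lies in an even number of them. Then there exists a maximum cyclic $(2q-1)$-even-free packing of order $q^m-1$ and block size $q$. Moreover, such a packing can be obtained from the points and lines of the affine geometry $\mathrm{AG}(m,q)$ as follows. There is an automorphism $\sigma$ of $\mathrm{AG}(m,q)$ (a permutation of the points that maps the set of lines onto itself) which fixes one point $p$ and permutes the other $q^m-1$ points in a single cycle; the lines through $p$ form a single orbit under $\langle\sigma\rangle$; and the packing is the set system obtained by removing $p$ and all lines through $p$, with the remaining points identified with $\mathbb{Z}/(q^m-1)\mathbb{Z}$ in such a way that $\sigma$ becomes $i \mapsto i+1$. -/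

import Mathlib

universe u

/-! A set system on a point type `V` is given by its family of blocks `B : Set (Set V)`. -/

namespace CyclicPacking

/-- `B` is the block family of a packing of order `v` and block size `k` (a `2-(v,k,1)` packing):
there are exactly `v` points, finitely many, every block has exactly `k` points, and two distinct
points lie together in at most one block. -/
def IsPacking {V : Type u} (v k : ℕ) (B : Set (Set V)) : Prop :=
  Finite V ∧ Nat.card V = v ∧ (∀ b ∈ B, b.ncard = k) ∧
    ∀ x y : V, x ≠ y → ∀ b ∈ B, ∀ c ∈ B, x ∈ b → y ∈ b → x ∈ c → y ∈ c → b = c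

/-- A packing is maximum if it has the largest number of blocks among *all* packings
(not only the cyclic ones) of the same order and block size. -/
def IsMaximumPacking {V : Type u} (v k : ℕ) (B : Set (Set V)) : Prop :=
  IsPacking v k B ∧
    ∀ (W : Type u) (C : Set (Set W)), IsPacking v k C → C.ncard ≤ B.ncard

/-- A set system on the points `ℤ/v` is cyclic if the translate by `1` of a block is a block. -/
def IsCyclicSystem {v : ℕ} (B : Set (Set (ZMod v))) : Prop :=
  ∀ b ∈ B, (fun x => x + 1) '' b ∈ B

/-- Every point lies in an even number of blocks of `C`. (The points outside the blocks of `C` lie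
in zero of them, so that it does not matter which point set containing these blocks is used.) -/
def IsEvenConfig {V : Type u} (C : Set (Set V)) : Prop :=
  ∀ a : V, Even {b | b ∈ C ∧ a ∈ b}.ncard

/-- `B` is `r`-even-free: for `1 ≤ i ≤ r`, no `i` blocks of `B` form an even configuration. -/
def IsEvenFree {V : Type u} (r : ℕ) (B : Set (Set V)) : Prop :=
  ∀ i : ℕ, 1 ≤ i → i ≤ r → ¬ ∃ C : Set (Set V), C ⊆ B ∧ C.Finite ∧ C.ncard = i ∧ IsEvenConfig C

/-- The bijection `τ` is an isomorphism of set systems. -/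
def IsIsomorphism {V W : Type u} (B : Set (Set V)) (C : Set (Set W)) (τ : V ≃ W) : Prop :=
  (fun b => τ '' b) '' B = C

/-- The set system of the points and lines of the affine geometry `AG(m, F)`: the points are the
vectors of `F ^ m`, the blocks are the lines through two distinct points. -/
def affineLines (m : ℕ) (F : Type u) [Field F] : Set (Set (Fin m → F)) :=
  {L | ∃ x y : Fin m → F, x ≠ y ∧ L = (affineSpan F {x, y} : Set (Fin m → F))}

/-- The set system obtained from `B` by removing the point `p` and all blocks through `p`. -/
def deletePoint {V : Type u} (B : Set (Set V)) (p : V) : Set (Set {x : V // x ≠ p}) :=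
  {b | Subtype.val '' b ∈ B}

/-- The orbit of a set of points under the group generated by the permutation `σ`. -/
def blockOrbit {V : Type u} (σ : Equiv.Perm V) (b : Set V) : Set (Set V) :=
  {c | ∃ i : ℤ, c = (σ ^ i) '' b}

end CyclicPacking

section

open scoped Classical

namespace CyclicPacking

/-! Identify `F ^ m` with the field `E` of order q^m. Multiplication by a generator of `Eˣ` is
linear, fixes 0 and permutes the other points in one cycle; this gives the automorphism and the
cyclic labelling.

Maximality is a degree bound. In any packing deg·(k-1) < v, while here a nonzero x fails to be
joined only to the q-1 nonzero points of the line through 0 and x (itself included), so every degree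
is the largest possible.

For even-freeness, take fewer than 2q lines covering every point evenly, and one of them, L₀.
Averaging over the functionals constant on L₀ (`exists_hyperplane_card_le_one`) gives a level set
containing L₀ and at most one other line. If L₀ is alone, each of its q points needs another line,
so there are at least q transversals. As q is odd, counting incidences mod 2 shows that every level
contains an odd number of lines, which adds q more. If there are two lines, their symmetric
difference has at least 2q-2 points, each needing its own transversal. Either way there are at least
2q lines, a contradiction. -/

/-- The lines `{x + t u | t ∈ F}`, `u ≠ 0`, of a vector space over `F`. -/
def IsLine (F : Type*) {V : Type*} [Field F] [AddCommGroup V] [Module F V] (L : Set V) : Prop :=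
  ∃ x u : V, u ≠ 0 ∧ L = Set.range fun t : F => x + t • u

/-! ### Incidence of lines and level sets of functionals -/

section Lines

variable {F V : Type*} [Field F] [AddCommGroup V] [Module F V] {L M : Set V} {x y : V}

theorem IsLine.exists_eq_range (hL : IsLine F L) (hx : x ∈ L) :
    ∃ u : V, u ≠ 0 ∧ L = Set.range fun t : F => x + t • u := by
  obtain ⟨z, u, hu, rfl⟩ := hL
  obtain ⟨s, rfl⟩ := hx
  refine ⟨u, hu, Set.ext fun y => ⟨?_, ?_⟩⟩
  · rintro ⟨t, rfl⟩
    exact ⟨t - s, by simp only [sub_smul]; abel⟩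
  · rintro ⟨t, rfl⟩
    exact ⟨s + t, by simp only [add_smul]; abel⟩

theorem IsLine.nonempty (hL : IsLine F L) : L.Nonempty := by
  obtain ⟨z, u, hu, rfl⟩ := hL
  exact Set.range_nonempty _

theorem IsLine.ncard_eq (hL : IsLine F L) : L.ncard = Nat.card F := by
  obtain ⟨z, u, hu, rfl⟩ := hL
  rw [← Nat.card_coe_set_eq]
  refine Nat.card_range_of_injective fun s t hst => ?_
  exact smul_left_injective F hu (add_left_cancel hst)

theorem IsLine.eq_range_sub (hL : IsLine F L) (hx : x ∈ L) (hy : y ∈ L) (hxy : x ≠ y) :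
    L = Set.range fun t : F => x + t • (y - x) := by
  obtain ⟨u, hu, rfl⟩ := hL.exists_eq_range hx
  obtain ⟨s, rfl⟩ := hy
  have hs : s ≠ 0 := by
    rintro rfl
    simp at hxy
  refine Set.ext fun z => ⟨?_, ?_⟩
  · rintro ⟨t, rfl⟩
    exact ⟨t * s⁻¹, by simp [smul_smul, hs]⟩
  · rintro ⟨t, rfl⟩
    exact ⟨t * s, by simp [smul_smul]⟩

theorem IsLine.eq_of_mem (hL : IsLine F L) (hM : IsLine F M) (hxy : x ≠ y) (hxL : x ∈ L)
    (hyL : y ∈ L) (hxM : x ∈ M) (hyM : y ∈ M) : L = M := by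
  rw [hL.eq_range_sub hxL hyL hxy, hM.eq_range_sub hxM hyM hxy]

theorem exists_isLine (hxy : x ≠ y) : ∃ L : Set V, IsLine F L ∧ x ∈ L ∧ y ∈ L :=
  ⟨_, ⟨x, y - x, sub_ne_zero.2 hxy.symm, rfl⟩, ⟨0, by simp⟩, ⟨1, by simp⟩⟩

theorem mem_affineLines_iff {m : ℕ} {F : Type*} [Field F] {L : Set (Fin m → F)} :
    L ∈ affineLines m F ↔ IsLine F L := by
  have key : ∀ x y : Fin m → F, (affineSpan F {x, y} : Set (Fin m → F)) =
      Set.range fun t : F => x + t • (y - x) := by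
    intro x y
    ext z
    rw [SetLike.mem_coe, mem_affineSpan_pair_iff_exists_lineMap_eq]
    simp [AffineMap.lineMap_apply, add_comm]
  constructor
  · rintro ⟨x, y, hxy, rfl⟩
    exact ⟨x, y - x, sub_ne_zero.2 hxy.symm, key x y⟩
  · rintro ⟨x, u, hu, rfl⟩
    refine ⟨x, x + u, by simpa using hu, ?_⟩
    rw [key]
    simp

/-- A line meets a hyperplane that does not contain it in at most one point. -/
theorem IsLine.eq_of_mem_hyperplane (hL : IsLine F L) {f : Module.Dual F V} {c : F}
    (hLf : ¬ ∀ z ∈ L, f z = c) (hx : x ∈ L) (hy : y ∈ L) (hxf : f x = c) (hyf : f y = c) :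
    x = y := by
  by_contra hxy
  refine hLf fun z hz => ?_
  rw [hL.eq_range_sub hx hy hxy] at hz
  obtain ⟨t, rfl⟩ := hz
  simp [hxf, hyf]

/-- A line that is not parallel to a hyperplane meets it in a point. -/
theorem IsLine.exists_mem_hyperplane (hL : IsLine F L) {f : Module.Dual F V}
    (hLf : ∀ c, ¬ ∀ z ∈ L, f z = c) (c : F) : ∃ x ∈ L, f x = c := by
  obtain ⟨z, u, hu, rfl⟩ := hL
  have hfu : f u ≠ 0 := by
    intro h
    refine hLf (f z) ?_
    rintro _ ⟨t, rfl⟩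
    simp [h]
  exact ⟨_, ⟨(c - f z) / f u, rfl⟩, by simp [hfu]⟩

end Lines

/-! ### Lower bound 2q for even configurations of lines -/

section EvenConfigurations

/-- The sum of the degrees of the points of `S` counts the incidences in `S`. -/
theorem sum_degree_eq {V : Type*} (C : Finset (Set V)) (S : Finset V) :
    ∑ x ∈ S, (C.filter fun L => x ∈ L).card = ∑ L ∈ C, (S.filter fun x => x ∈ L).card :=
  Finset.sum_card_bipartiteAbove_eq_sum_card_bipartiteBelow _

theorem exists_ne_mem_of_even {V : Type*} {C : Finset (Set V)} {L : Set V} {x : V} (heven : Even (C.filter fun L => x ∈ L).card)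
    (hL : L ∈ C) (hx : x ∈ L) : ∃ M ∈ C, M ≠ L ∧ x ∈ M := by
  have hmem : L ∈ C.filter fun L => x ∈ L := Finset.mem_filter.2 ⟨hL, hx⟩
  have hpos : 0 < (C.filter fun L => x ∈ L).card := Finset.card_pos.2 ⟨L, hmem⟩
  have h1 : 1 < (C.filter fun L => x ∈ L).card := by
    obtain ⟨k, hk⟩ := heven
    omega
  obtain ⟨M, hM, hne⟩ := Finset.exists_mem_ne h1 L
  exact ⟨M, (Finset.mem_filter.1 hM).1, hne, (Finset.mem_filter.1 hM).2⟩

variable {F V : Type*} [Field F] [AddCommGroup V] [Module F V] [Fintype V]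
  {C : Finset (Set V)}

theorem card_filter_hyperplane_eq_one {L : Set V} (hL : IsLine F L) {f : Module.Dual F V}
    (hLf : ∀ c, ¬ ∀ z ∈ L, f z = c) (c : F) :
    ((Finset.univ.filter fun x => f x = c).filter fun x => x ∈ L).card = 1 := by
  obtain ⟨x, hxL, hxf⟩ := hL.exists_mem_hyperplane hLf c
  refine Finset.card_eq_one.2 ⟨x, Finset.ext fun y => ?_⟩
  simp only [Finset.mem_filter, Finset.mem_univ, true_and, Finset.mem_singleton]
  constructor
  · rintro ⟨hyf, hyL⟩
    exact hL.eq_of_mem_hyperplane (hLf c) hyL hxL hyf hxf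
  · rintro rfl
    exact ⟨hxf, hxL⟩

theorem card_filter_hyperplane_eq_zero {L : Set V} {f : Module.Dual F V}
    {c d : F} (hcd : c ≠ d) (hLf : ∀ z ∈ L, f z = d) :
    ((Finset.univ.filter fun x => f x = c).filter fun x => x ∈ L).card = 0 := by
  rw [Finset.card_eq_zero, Finset.eq_empty_iff_forall_notMem]
  intro y hy
  simp only [Finset.mem_filter, Finset.mem_univ, true_and] at hy
  exact hcd (hy.1.symm.trans (hLf y hy.2))

variable [Fintype F]

theorem card_filter_hyperplane_eq_card {L : Set V} (hL : IsLine F L) {f : Module.Dual F V}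
    {c : F} (hLf : ∀ z ∈ L, f z = c) :
    ((Finset.univ.filter fun x => f x = c).filter fun x => x ∈ L).card = Fintype.card F := by
  rw [← Nat.card_eq_fintype_card, ← hL.ncard_eq, Set.ncard_eq_toFinset_card']
  congr 1
  ext y
  simpa using hLf y

/-- In an even configuration of lines, the lines contained in a hyperplane have the same parity as
the lines that are transversal to it. -/
theorem even_card_transversal_add (hF : Odd (Fintype.card F)) (hC : ∀ L ∈ C, IsLine F L)
    (heven : ∀ x, Even (C.filter fun L => x ∈ L).card) (f : Module.Dual F V) (c : F) :
    Even ((C.filter fun L => ∀ d, ¬ ∀ z ∈ L, f z = d).card +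
      (C.filter fun L => ∀ z ∈ L, f z = c).card) := by
  have hsum : Even (∑ L ∈ C, ((Finset.univ.filter fun x => f x = c).filter
      fun x => x ∈ L).card) := by
    rw [← sum_degree_eq]
    exact Finset.even_sum _ fun x _ => heven x
  -- A line meets the level set in 1, q or 0 points: it is transversal, contained, or inside another
  -- level.
  have hterm : ∀ L ∈ C, ((Finset.univ.filter fun x => f x = c).filter fun x => x ∈ L).card =
      (if ∀ d, ¬ ∀ z ∈ L, f z = d then 1 else 0) +
        (if ∀ z ∈ L, f z = c then 1 else 0) * Fintype.card F := by
    intro L hL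
    by_cases h1 : ∀ d, ¬ ∀ z ∈ L, f z = d
    · rw [card_filter_hyperplane_eq_one (hC L hL) h1, if_pos h1, if_neg (h1 c)]
      simp
    · rw [if_neg h1]
      by_cases h2 : ∀ z ∈ L, f z = c
      · rw [card_filter_hyperplane_eq_card (hC L hL) h2, if_pos h2]
        simp
      · push Not at h1
        obtain ⟨d, hd⟩ := h1
        have hcd : c ≠ d := by
          rintro rfl
          exact h2 hd
        rw [card_filter_hyperplane_eq_zero hcd hd, if_neg h2]
        simp
  rw [Finset.sum_congr rfl hterm, Finset.sum_add_distrib, ← Finset.sum_mul, Finset.sum_boole,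
    Finset.sum_boole] at hsum
  simp only [Nat.cast_id] at hsum
  rw [Nat.even_add, Nat.even_mul] at hsum
  rw [Nat.even_add, hsum]
  simp [Nat.not_even_iff_odd.2 hF]

/-- If each point of a subset `S` of a hyperplane is on a line of `C` that is not contained in the
hyperplane, there are at least `|S|` lines in `C` transversal to it. -/
theorem card_le_card_transversal (hC : ∀ L ∈ C, IsLine F L) {f : Module.Dual F V} {c : F}
    {S : Finset V} (hS : ∀ x ∈ S, f x = c)
    (hSC : ∀ x ∈ S, ∃ L ∈ C, x ∈ L ∧ ¬ ∀ z ∈ L, f z = c) :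
    S.card ≤ (C.filter fun L => ∀ d, ¬ ∀ z ∈ L, f z = d).card := by
  choose! g hgC hgx hgf using hSC
  -- A line not inside the hyperplane meets it at most once, so distinct points choose distinct
  -- lines.
  refine Finset.card_le_card_of_injOn g ?_ ?_
  · intro x hx
    refine Finset.mem_coe.2 (Finset.mem_filter.2 ⟨hgC x hx, fun d hd => hgf x hx ?_⟩)
    rw [← hS x hx, hd x (hgx x hx)]
    exact hd
  · intro x hx y hy hxy
    refine (hC _ (hgC x hx)).eq_of_mem_hyperplane (hgf x hx) (hgx x hx) ?_ (hS x hx) (hS y hy)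
    rw [hxy]
    exact hgx y hy

/-- Lines on which `f` is constant are never transversal, so the two lower bounds add up. -/
theorem card_transversal_add_le (f : Module.Dual F V) (D : Finset (Set V)) (hD : D ⊆ C) (hDf : ∀ L ∈ D, ∃ d, ∀ z ∈ L, f z = d) :
    (C.filter fun L => ∀ d, ¬ ∀ z ∈ L, f z = d).card + D.card ≤ C.card := by
  rw [← Finset.card_union_of_disjoint]
  · exact Finset.card_le_card (Finset.union_subset (Finset.filter_subset _ _) hD)
  · rw [Finset.disjoint_left]
    intro L hL hLD
    obtain ⟨d, hd⟩ := hDf L hLD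
    exact (Finset.mem_filter.1 hL).2 d hd

/-- An even configuration with exactly one line in some hyperplane has at least `2q` lines. -/
theorem two_mul_le_card_of_one_line (hF : Odd (Fintype.card F)) (hC : ∀ L ∈ C, IsLine F L)
    (heven : ∀ x, Even (C.filter fun L => x ∈ L).card) {f : Module.Dual F V} {c : F}
    {L₀ : Set V} (h : (C.filter fun L => ∀ z ∈ L, f z = c) = {L₀}) :
    2 * Fintype.card F ≤ C.card := by
  have hL₀ : L₀ ∈ C ∧ ∀ z ∈ L₀, f z = c :=
    Finset.mem_filter.1 (h.ge (show L₀ ∈ _ by simp))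
  have htrans : Fintype.card F ≤ (C.filter fun L => ∀ d, ¬ ∀ z ∈ L, f z = d).card := by
    rw [← Nat.card_eq_fintype_card, ← (hC L₀ hL₀.1).ncard_eq, Set.ncard_eq_toFinset_card']
    refine card_le_card_transversal hC (c := c) (fun x hx => hL₀.2 x (by simpa using hx))
      fun x hx => ?_
    obtain ⟨M, hM, hne, hxM⟩ := exists_ne_mem_of_even (heven x) hL₀.1 (by simpa using hx)
    refine ⟨M, hM, hxM, fun hMf => hne ?_⟩
    rw [← Finset.mem_singleton, ← h]
    exact Finset.mem_filter.2 ⟨hM, hMf⟩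
  -- Level `c` holds exactly one line, so the number of transversals is odd, and hence so is the
  -- number of lines in each level.
  have hodd : ∀ d, ∃ L ∈ C, ∀ z ∈ L, f z = d := by
    intro d
    have h1 := even_card_transversal_add hF hC heven f c
    have h2 := even_card_transversal_add hF hC heven f d
    rw [h, Finset.card_singleton] at h1
    have h3 : 0 < (C.filter fun L => ∀ z ∈ L, f z = d).card := by
      by_contra h0
      rw [not_lt, Nat.le_zero] at h0
      rw [h0] at h2
      obtain ⟨a, ha⟩ := h1
      obtain ⟨b, hb⟩ := h2
      omega
    obtain ⟨L, hL⟩ := Finset.card_pos.1 h3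
    exact ⟨L, Finset.mem_filter.1 hL⟩
  choose g hgC hgf using hodd
  have hcard : (Finset.univ.image g).card = Fintype.card F := by
    refine Finset.card_image_of_injective _ fun d e hde => ?_
    obtain ⟨z, hz⟩ := (hC _ (hgC d)).nonempty
    rw [← hgf d z hz, ← hgf e z (hde ▸ hz)]
  have hle := card_transversal_add_le f (Finset.univ.image g)
    (by intro L hL; obtain ⟨d, -, rfl⟩ := Finset.mem_image.1 hL; exact hgC d)
    (by intro L hL; obtain ⟨d, -, rfl⟩ := Finset.mem_image.1 hL; exact ⟨d, hgf d⟩)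
  omega

/-- An even configuration with exactly two lines in some hyperplane has at least `2q` lines. -/
theorem two_mul_le_card_of_two_lines (hC : ∀ L ∈ C, IsLine F L)
    (heven : ∀ x, Even (C.filter fun L => x ∈ L).card) {f : Module.Dual F V} {c : F}
    {L₀ L₁ : Set V} (hne : L₀ ≠ L₁) (h : (C.filter fun L => ∀ z ∈ L, f z = c) = {L₀, L₁}) :
    2 * Fintype.card F ≤ C.card := by
  have hL₀ : L₀ ∈ C ∧ ∀ z ∈ L₀, f z = c :=
    Finset.mem_filter.1 (h.ge (show L₀ ∈ _ by simp))
  have hL₁ : L₁ ∈ C ∧ ∀ z ∈ L₁, f z = c :=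
    Finset.mem_filter.1 (h.ge (show L₁ ∈ _ by simp))
  have hmem : ∀ M ∈ C, (∀ z ∈ M, f z = c) → M = L₀ ∨ M = L₁ := by
    intro M hM hMf
    have : M ∈ ({L₀, L₁} : Finset (Set V)) := by
      rw [← h]
      exact Finset.mem_filter.2 ⟨hM, hMf⟩
    simpa using this
  have c₀ : L₀.toFinset.card = Fintype.card F := by
    rw [← Set.ncard_eq_toFinset_card', (hC L₀ hL₀.1).ncard_eq, Nat.card_eq_fintype_card]
  have c₁ : L₁.toFinset.card = Fintype.card F := by
    rw [← Set.ncard_eq_toFinset_card', (hC L₁ hL₁.1).ncard_eq, Nat.card_eq_fintype_card]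
  have hinter : (L₀.toFinset ∩ L₁.toFinset).card ≤ 1 := by
    refine Finset.card_le_one.2 fun x hx y hy => ?_
    simp only [Finset.mem_inter, Set.mem_toFinset] at hx hy
    by_contra hxy
    exact hne ((hC _ hL₀.1).eq_of_mem (hC _ hL₁.1) hxy hx.1 hy.1 hx.2 hy.2)
  have htrans : (L₀.toFinset \ L₁.toFinset ∪ L₁.toFinset \ L₀.toFinset).card ≤
      (C.filter fun L => ∀ d, ¬ ∀ z ∈ L, f z = d).card := by
    refine card_le_card_transversal hC (c := c) (fun x hx => ?_) fun x hx => ?_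
    · simp only [Finset.mem_union, Finset.mem_sdiff, Set.mem_toFinset] at hx
      rcases hx with hx | hx
      exacts [hL₀.2 x hx.1, hL₁.2 x hx.1]
    · simp only [Finset.mem_union, Finset.mem_sdiff, Set.mem_toFinset] at hx
      rcases hx with hx | hx
      · obtain ⟨M, hM, hne, hxM⟩ := exists_ne_mem_of_even (heven x) hL₀.1 hx.1
        refine ⟨M, hM, hxM, fun hMf => ?_⟩
        rcases hmem M hM hMf with rfl | rfl
        exacts [hne rfl, hx.2 hxM]
      · obtain ⟨M, hM, hne, hxM⟩ := exists_ne_mem_of_even (heven x) hL₁.1 hx.1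
        refine ⟨M, hM, hxM, fun hMf => ?_⟩
        rcases hmem M hM hMf with rfl | rfl
        exacts [hx.2 hxM, hne rfl]
  rw [Finset.card_union_of_disjoint disjoint_sdiff_sdiff] at htrans
  have s₀ := Finset.card_sdiff_add_card_inter L₀.toFinset L₁.toFinset
  have s₁ := Finset.card_sdiff_add_card_inter L₁.toFinset L₀.toFinset
  rw [Finset.inter_comm] at s₁
  have hle := card_transversal_add_le (C := C) f {L₀, L₁}
    (by simp [Finset.insert_subset_iff, hL₀.1, hL₁.1])
    (by simpa using ⟨⟨c, hL₀.2⟩, ⟨c, hL₁.2⟩⟩)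
  rw [Finset.card_pair hne] at hle
  omega

/-- The number of linear functionals that vanish on a subspace. -/
theorem card_dualAnnihilator_mul (W : Submodule F V) :
    Nat.card W.dualAnnihilator * Fintype.card F ^ Module.finrank F W =
      Fintype.card F ^ Module.finrank F V := by
  rw [← Nat.card_eq_fintype_card, Module.natCard_eq_pow_finrank (K := F), ← pow_add,
    ← Subspace.finrank_add_finrank_dualAnnihilator_eq W, add_comm]

/-- A line is contained in a hyperplane (a level set of a functional) that contains at most one line
of a given small family of other lines. -/
theorem exists_hyperplane_card_le_one (hF : 2 ≤ Fintype.card F) (hV : 2 ≤ Module.finrank F V)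
    (hC : ∀ L ∈ C, IsLine F L) {L₀ : Set V} (h₀ : IsLine F L₀) (hL₀ : L₀ ∉ C)
    (hcard : C.card ≤ 2 * Fintype.card F - 2) :
    ∃ (f : Module.Dual F V) (c : F), (∀ z ∈ L₀, f z = c) ∧
      (C.filter fun L => ∀ z ∈ L, f z = c).card ≤ 1 := by
  -- Double count pairs (functional constant on `L₀`, line of `C` in the same level): failure would
  -- give 2·q^(k+1) ≤ |C|·q^k, where dim V = k + 2.
  by_contra! hcon
  obtain ⟨x, u, hu, hxu⟩ := id h₀
  have : Finite (Module.Dual F V) := Finite.of_injective _ DFunLike.coe_injective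
  have : Fintype (Module.Dual F V) := Fintype.ofFinite _
  -- The zero functional is kept: its level set is the whole space, and the bounds above hold for it
  -- too.
  set A : Submodule F (Module.Dual F V) := (F ∙ u).dualAnnihilator with hA
  have hAmem : ∀ f : Module.Dual F V, f ∈ A ↔ f u = 0 := by
    intro f
    rw [hA, Submodule.mem_dualAnnihilator]
    refine ⟨fun h => h u (Submodule.mem_span_singleton_self u), fun h w hw => ?_⟩
    obtain ⟨t, rfl⟩ := Submodule.mem_span_singleton.1 hw
    simp [h]
  set q := Fintype.card F
  obtain ⟨k, hk⟩ : ∃ k, Module.finrank F V = k + 2 := ⟨_, (Nat.sub_add_cancel hV).symm⟩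
  have hAcard : (Finset.univ.filter fun f => f ∈ A).card = q ^ k * q := by
    have h1 := card_dualAnnihilator_mul (F ∙ u)
    rw [finrank_span_singleton hu, hk, pow_one, pow_succ, pow_succ] at h1
    have h2 := Nat.eq_of_mul_eq_mul_right (by omega) h1
    rw [← h2, Nat.card_eq_fintype_card, Fintype.card_subtype]
  have hbelow : ∀ L ∈ C,
      ((Finset.univ.filter fun f => f ∈ A).filter fun f => ∀ z ∈ L, f z = f x).card ≤ q ^ k := by
    intro L hL
    obtain ⟨z, hzL, hz₀⟩ : ∃ z ∈ L, z ∉ L₀ := by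
      by_contra! hsub
      refine hL₀ ?_
      have : L = L₀ := Set.eq_of_subset_of_ncard_le hsub (by
        rw [h₀.ncard_eq, (hC L hL).ncard_eq]) (Set.toFinite _)
      exact this ▸ hL
    -- A functional counted here kills both `u` and `z - x`; independence leaves only q^k of them.
    have hind : LinearIndependent F ![u, z - x] := by
      rw [LinearIndependent.pair_iff' hu]
      intro t ht
      refine hz₀ ?_
      rw [hxu]
      exact ⟨t, by simp [ht]⟩
    have h1 := card_dualAnnihilator_mul (Submodule.span F (Set.range ![u, z - x]))
    rw [finrank_span_eq_card hind, hk, Fintype.card_fin, pow_add] at h1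
    have h2 := Nat.eq_of_mul_eq_mul_right (by positivity) h1
    rw [← h2, Nat.card_eq_fintype_card, Fintype.card_subtype]
    refine Finset.card_le_card fun f hf => ?_
    simp only [Finset.mem_filter, Finset.mem_univ, true_and, hAmem] at hf ⊢
    rw [Submodule.mem_dualAnnihilator]
    intro w hw
    induction hw using Submodule.span_induction with
    | mem w hw =>
      obtain ⟨i, rfl⟩ := hw
      fin_cases i
      · exact hf.1
      · simp [hf.2 z hzL]
    | zero => simp
    | add a b _ _ ha hb => rw [map_add, ha, hb, add_zero]
    | smul a b _ hb => rw [map_smul, hb, smul_zero]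
  have habove : ∀ f ∈ Finset.univ.filter fun f => f ∈ A,
      2 ≤ (C.filter fun L => ∀ z ∈ L, f z = f x).card := by
    intro f hf
    refine hcon f (f x) ?_
    rw [hxu]
    rintro _ ⟨t, rfl⟩
    simp [(hAmem f).1 (Finset.mem_filter.1 hf).2]
  have hsum : ∑ f ∈ Finset.univ.filter (fun f => f ∈ A),
      (C.filter fun L => ∀ z ∈ L, f z = f x).card =
      ∑ L ∈ C, ((Finset.univ.filter fun f => f ∈ A).filter fun f => ∀ z ∈ L, f z = f x).card :=
    Finset.sum_card_bipartiteAbove_eq_sum_card_bipartiteBelow _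
  have hlow := Finset.card_nsmul_le_sum _ _ _ habove
  have hup := Finset.sum_le_card_nsmul _ _ _ hbelow
  rw [hsum, hAcard] at hlow
  have := hlow.trans hup
  simp only [smul_eq_mul] at this
  have hpos : 0 < q ^ k := by positivity
  have h3 : C.card < 2 * q := by omega
  have h4 := Nat.mul_lt_mul_of_pos_right h3 hpos
  linarith [mul_comm (q ^ k) q, mul_assoc 2 q (q ^ k)]

end EvenConfigurations

/-! ### Maximality from degrees -/

section Degrees

variable {V W : Type*} [Fintype V] [Fintype W] {v k : ℕ}

theorem IsPacking.card_mul_eq_sum_degree {B : Finset (Set V)}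
    (hB : IsPacking v k (B : Set (Set V))) :
    B.card * k = ∑ x, (B.filter fun b => x ∈ b).card := by
  rw [sum_degree_eq, Finset.sum_const_nat (m := k)]
  intro b hb
  rw [← hB.2.2.1 b hb, Set.ncard_eq_toFinset_card']
  congr 1
  ext y
  simp

/-- The points joined to `x` by a block are distributed equally to the blocks through `x`. -/
theorem IsPacking.degree_mul {B : Finset (Set V)} (hB : IsPacking v k (B : Set (Set V))) (x : V) :
    (B.filter fun b => x ∈ b).card * (k - 1) =
      (Finset.univ.filter fun y => y ≠ x ∧ ∃ b ∈ B, x ∈ b ∧ y ∈ b).card := by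
  rw [← mul_one (Finset.card (Finset.univ.filter _))]
  refine Finset.card_mul_eq_card_mul (fun (b : Set V) y => y ∈ b) (fun b hb => ?_) fun y hy => ?_
  · rw [Finset.mem_filter] at hb
    rw [← hB.2.2.1 b hb.1, Set.ncard_eq_toFinset_card',
      ← Finset.card_erase_of_mem (Set.mem_toFinset.2 hb.2)]
    congr 1
    ext y
    simp only [Finset.mem_bipartiteAbove, Finset.mem_filter, Finset.mem_univ, true_and,
      Finset.mem_erase, Set.mem_toFinset]
    exact ⟨fun h => ⟨h.1.1, h.2⟩, fun h => ⟨⟨h.1, b, hb.1, hb.2, h.2⟩, h.2⟩⟩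
  · simp only [Finset.mem_filter, Finset.mem_univ, true_and] at hy
    obtain ⟨hyx, b, hb, hxb, hyb⟩ := hy
    refine Finset.card_eq_one.2 ⟨b, Finset.ext fun c => ?_⟩
    simp only [Finset.mem_bipartiteBelow, Finset.mem_filter, Finset.mem_singleton]
    constructor
    · rintro ⟨⟨hc, hxc⟩, hyc⟩
      exact hB.2.2.2 x y hyx.symm c hc b hb hxc hyc hxb hyb
    · rintro rfl
      exact ⟨⟨hb, hxb⟩, hyb⟩

/-- If each point of `B` is joined to all but at most `k - 1` points (counting itself), then no
packing has larger degrees than `B`. -/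
theorem IsPacking.degree_le {B : Finset (Set V)} {C : Finset (Set W)}
    (hB : IsPacking v k (B : Set (Set V))) (hC : IsPacking v k (C : Set (Set W))) {x : V}
    (hx : (Finset.univ.filter fun y => ¬ (y ≠ x ∧ ∃ b ∈ B, x ∈ b ∧ y ∈ b)).card ≤ k - 1) (w : W) :
    (C.filter fun b => w ∈ b).card ≤ (B.filter fun b => x ∈ b).card := by
  have h1 := hB.degree_mul x
  have h2 := Finset.card_filter_add_card_filter_not (s := Finset.univ)
    fun y => y ≠ x ∧ ∃ b ∈ B, x ∈ b ∧ y ∈ b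
  -- Strict because `w` is not counted as joined to itself.
  have h3 : (C.filter fun b => w ∈ b).card * (k - 1) < v := by
    rw [hC.degree_mul w, ← hC.2.1, Nat.card_eq_fintype_card, ← Finset.card_univ]
    exact Finset.card_lt_card (Finset.filter_ssubset.2 ⟨w, Finset.mem_univ _, by simp⟩)
  rw [Finset.card_univ, ← Nat.card_eq_fintype_card, hB.2.1, ← h1] at h2
  have h4 : (C.filter fun b => w ∈ b).card * (k - 1) <
      ((B.filter fun b => x ∈ b).card + 1) * (k - 1) := by
    rw [add_mul]
    omega
  exact Nat.lt_succ_iff.1 (Nat.lt_of_mul_lt_mul_right h4)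

end Degrees

/-- A packing in which each point is joined to all but at most `k - 1` points (counting itself)
is maximum. -/
theorem IsPacking.isMaximumPacking {V : Type u} {v k : ℕ} {B : Set (Set V)} (hk : 0 < k)
    (hB : IsPacking v k B)
    (hjoin : ∀ x, {y | ¬ (y ≠ x ∧ ∃ b ∈ B, x ∈ b ∧ y ∈ b)}.ncard ≤ k - 1) :
    IsMaximumPacking v k B := by
  refine ⟨hB, fun W C hC => ?_⟩
  have := hB.1
  have := hC.1
  have := Fintype.ofFinite V
  have := Fintype.ofFinite W
  lift B to Finset (Set V) using Set.toFinite B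
  lift C to Finset (Set W) using Set.toFinite C
  rw [Set.ncard_coe_finset, Set.ncard_coe_finset]
  refine Nat.le_of_mul_le_mul_right ?_ hk
  obtain ⟨e⟩ : Nonempty (W ≃ V) := Finite.card_eq.1 (hC.2.1.trans hB.2.1.symm)
  rw [hB.card_mul_eq_sum_degree, hC.card_mul_eq_sum_degree, ← e.sum_comp]
  refine Finset.sum_le_sum fun w _ => hB.degree_le hC ?_ w
  convert hjoin (e w) using 1
  rw [Set.ncard_eq_toFinset_card']
  congr 1
  ext y
  simp

/-! ### The punctured affine geometry -/

/-- The lines of `V` that do not pass through the origin, where the other points of `V` are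
labelled by `ι`. -/
def puncturedLines (F : Type*) {V P : Type*} [Field F] [AddCommGroup V] [Module F V] (ι : P → V) :
    Set (Set P) :=
  {b | IsLine F (ι '' b)}

section Punctured

variable {F V : Type*} [Field F] [AddCommGroup V] [Module F V] {P : Type u} {ι : P → V}

theorem isPacking_puncturedLines [Finite P] (hι : Function.Injective ι) :
    IsPacking (Nat.card P) (Nat.card F) (puncturedLines F ι) := by
  refine ⟨inferInstance, rfl, fun b hb => ?_, fun x y hxy b hb c hc hxb hyb hxc hyc => ?_⟩
  · rw [← Set.ncard_image_of_injective b hι]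
    exact IsLine.ncard_eq hb
  · exact hι.image_injective (IsLine.eq_of_mem hb hc (hι.ne hxy) (Set.mem_image_of_mem ι hxb)
      (Set.mem_image_of_mem ι hyb) (Set.mem_image_of_mem ι hxc) (Set.mem_image_of_mem ι hyc))

theorem isMaximumPacking_puncturedLines [Finite F] [Finite P] (hι : Function.Injective ι)
    (hrange : Set.range ι = {0}ᶜ) :
    IsMaximumPacking (Nat.card P) (Nat.card F) (puncturedLines F ι) := by
  refine (isPacking_puncturedLines hι).isMaximumPacking Nat.card_pos fun x => ?_
  have hne : ∀ y, ι y ≠ 0 := fun y => by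
    have : ι y ∈ Set.range ι := ⟨y, rfl⟩
    rwa [hrange] at this
  obtain ⟨L, hL, h0, hx⟩ := exists_isLine (F := F) (hne x).symm
  have hLfin : L.Finite := Set.finite_of_ncard_pos (by rw [hL.ncard_eq]; exact Nat.card_pos)
  rw [← hL.ncard_eq, ← Set.ncard_sdiff_singleton_of_mem h0, ← Set.ncard_image_of_injective _ hι]
  refine Set.ncard_le_ncard ?_ hLfin.sdiff
  rintro _ ⟨y, hy, rfl⟩
  refine ⟨?_, hne y⟩
  by_contra hyL
  have hyx : y ≠ x := by
    rintro rfl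
    exact hyL hx
  -- The line through x and y avoids 0, since otherwise it would be `L`; so it survives the
  -- puncturing.
  obtain ⟨M, hM, hxM, hyM⟩ := exists_isLine (F := F) (hι.ne hyx).symm
  refine hy ⟨hyx, ι ⁻¹' M, ?_, hxM, hyM⟩
  rw [puncturedLines, Set.mem_ofPred_eq, Set.image_preimage_eq_of_subset]
  · exact hM
  · rw [hrange]
    rintro z hz rfl
    exact hyL (hL.eq_of_mem hM (hne x) hx h0 hxM hz ▸ hyM)

/-- Points outside the range of `ι` lie on none of the chosen lines, so an even configuration stays
even in `V`, where the 2q bound applies. -/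
theorem isEvenFree_puncturedLines [Finite F] [Module.Finite F V] (hF : Odd (Nat.card F))
    (hV : 2 ≤ Module.finrank F V) (hι : Function.Injective ι) :
    IsEvenFree (2 * Nat.card F - 1) (puncturedLines F ι) := by
  rintro i hi1 hi ⟨C, hCB, hCfin, rfl, heven⟩
  have : Finite V := Module.finite_of_finite F
  have := Fintype.ofFinite F
  have := Fintype.ofFinite V
  lift C to Finset (Set P) using hCfin
  rw [Set.ncard_coe_finset] at hi1 hi
  rw [Nat.card_eq_fintype_card] at hF hi
  have hinj := hι.image_injective
  set D : Finset (Set V) := C.image (ι '' ·) with hD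
  have hDcard : D.card = C.card := Finset.card_image_of_injective _ hinj
  have hDline : ∀ L ∈ D, IsLine F L := by
    intro L hL
    obtain ⟨b, hb, rfl⟩ := Finset.mem_image.1 hL
    exact hCB hb
  have hDeven : ∀ x, Even (D.filter fun L => x ∈ L).card := by
    intro x
    rw [hD, Finset.filter_image, Finset.card_image_of_injective _ hinj]
    by_cases hx : x ∈ Set.range ι
    · obtain ⟨a, rfl⟩ := hx
      convert heven a
      rw [← Set.ncard_coe_finset]
      congr 1
      ext b
      simp [hι.eq_iff]
    · rw [Finset.filter_eq_empty_iff.2]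
      · simp
      · rintro b - ⟨a, -, rfl⟩
        exact hx ⟨a, rfl⟩
  obtain ⟨L₀, hL₀⟩ : D.Nonempty := Finset.card_pos.1 (by omega)
  have hF2 : 2 ≤ Fintype.card F := Fintype.one_lt_card
  obtain ⟨f, c, hL₀f, hle⟩ := exists_hyperplane_card_le_one (C := D.erase L₀) hF2 hV
    (fun L hL => hDline L (Finset.mem_of_mem_erase hL)) (hDline L₀ hL₀) (Finset.notMem_erase _ _)
    (by rw [Finset.card_erase_of_mem hL₀]; omega)
  have hsplit : (D.filter fun L => ∀ z ∈ L, f z = c) =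
      insert L₀ ((D.erase L₀).filter fun L => ∀ z ∈ L, f z = c) := by
    conv_lhs => rw [← Finset.insert_erase hL₀]
    rw [Finset.filter_insert, if_pos hL₀f]
  suffices 2 * Fintype.card F ≤ D.card by omega
  rcases Nat.le_one_iff_eq_zero_or_eq_one.1 hle with h | h
  · rw [Finset.card_eq_zero.1 h] at hsplit
    exact two_mul_le_card_of_one_line hF hDline hDeven hsplit
  · obtain ⟨L₁, hL₁⟩ := Finset.card_eq_one.1 h
    rw [hL₁] at hsplit
    refine two_mul_le_card_of_two_lines hDline hDeven ?_ hsplit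
    rintro rfl
    have := hL₁.ge (Finset.mem_singleton_self _)
    simp at this

end Punctured

/-! ### Singer cycles -/

/-- The elements of a finite cyclic group of order `n` can be labelled by `ZMod n` in such a way
that multiplication by a generator is `i ↦ i + 1`. -/
theorem exists_equiv_zmod_of_isCyclic (G : Type*) [Group G] [IsCyclic G] {n : ℕ}
    (hn : Nat.card G = n) :
    ∃ (g : G) (φ : ZMod n ≃ G), (∀ i, φ (i + 1) = g * φ i) ∧ ∀ w : G, ∃ i : ℤ, g ^ i = w := by
  subst hn
  let φ : Multiplicative (ZMod (Nat.card G)) ≃* G := zmodCyclicMulEquiv inferInstance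
  refine ⟨φ (Multiplicative.ofAdd 1), Multiplicative.ofAdd.trans φ.toEquiv, fun i => ?_,
    fun w => ?_⟩
  · rw [add_comm]
    simp [ofAdd_add]
  · obtain ⟨a, rfl⟩ := φ.surjective w
    obtain ⟨i, hi⟩ := ZMod.intCast_surjective a.toAdd
    refine ⟨i, ?_⟩
    rw [← map_zpow, ← ofAdd_zsmul, zsmul_one, hi, ofAdd_toAdd]

section Singer

variable {F E V : Type*} [Field F] [Field E] [Algebra F E] [AddCommGroup V] [Module F V]

/-- Multiplication by the units of `E`, as permutations of a vector space identified with `E`. -/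
def unitsPerm (e : E ≃ₗ[F] V) : Eˣ →* Equiv.Perm V :=
  e.toEquiv.permCongrHom.toMonoidHom.comp (MulAction.toPermHom Eˣ E)

theorem unitsPerm_apply (e : E ≃ₗ[F] V) (w : Eˣ) (x : V) :
    unitsPerm e w x = e (w * e.symm x) := rfl

theorem IsLine.image_unitsPerm {L : Set V} (hL : IsLine F L) (e : E ≃ₗ[F] V) (w : Eˣ) :
    IsLine F (unitsPerm e w '' L) := by
  obtain ⟨z, u, hu, rfl⟩ := hL
  refine ⟨unitsPerm e w z, unitsPerm e w u, ?_, ?_⟩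
  · simp [unitsPerm_apply, hu]
  · rw [← Set.range_comp]
    congr 1
    ext t
    simp [unitsPerm_apply, mul_add]

theorem isLine_image_unitsPerm_iff {L : Set V} (e : E ≃ₗ[F] V) (w : Eˣ) :
    IsLine F (unitsPerm e w '' L) ↔ IsLine F L := by
  refine ⟨fun h => ?_, fun h => h.image_unitsPerm e w⟩
  have := h.image_unitsPerm e w⁻¹
  rwa [← Set.image_comp, ← Equiv.Perm.coe_mul, ← map_mul, inv_mul_cancel, map_one,
    Equiv.Perm.coe_one, Set.image_id] at this

theorem unitsPerm_zero (e : E ≃ₗ[F] V) (w : Eˣ) : unitsPerm e w 0 = 0 := by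
  simp [unitsPerm_apply]

/-- The lines through the origin form one orbit under multiplication by a generator. -/
theorem setOf_isLine_zero_mem_eq_blockOrbit (e : E ≃ₗ[F] V) {g : Eˣ}
    (hg : ∀ w : Eˣ, ∃ i : ℤ, g ^ i = w) :
    {c | IsLine F c ∧ (0 : V) ∈ c} =
      blockOrbit (unitsPerm e g) (Set.range fun t : F => (0 : V) + t • e 1) := by
  ext c
  constructor
  · rintro ⟨hc, h0⟩
    obtain ⟨u, hu, rfl⟩ := hc.exists_eq_range h0
    -- The unit corresponding to the direction `u` carries `e 1` to `u`, hence the base line to the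
    -- given one.
    obtain ⟨i, hi⟩ := hg (Units.mk0 (e.symm u) (by simpa using hu))
    refine ⟨i, ?_⟩
    rw [← map_zpow, hi, ← Set.range_comp]
    congr 1
    ext t
    simp [unitsPerm_apply]
  · rintro ⟨i, rfl⟩
    rw [← map_zpow]
    refine ⟨IsLine.image_unitsPerm ⟨0, e 1, by simp, rfl⟩ e _, 0, ⟨0, by simp⟩, ?_⟩
    exact unitsPerm_zero e _

/-- The nonzero vectors of a space identified with `E` are the images of the units of `E`. -/
noncomputable def unitsEquivNeZero (e : E ≃ₗ[F] V) : Eˣ ≃ {x : V // x ≠ 0} :=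
  _root_.unitsEquivNeZero.trans (e.toEquiv.subtypeEquiv fun a => by simp)

end Singer

end CyclicPacking

end

/-! ### Assembly over the extension of degree m -/

theorem proposition2p9 (q m : ℕ) (hq : IsPrimePow q) (hodd : Odd q) (hm : 2 ≤ m) :
    ∃ B : Set (Set (ZMod (q ^ m - 1))),
      CyclicPacking.IsMaximumPacking (q ^ m - 1) q B ∧
      CyclicPacking.IsCyclicSystem B ∧
      CyclicPacking.IsEvenFree (2 * q - 1) B ∧
      -- `B` comes from `AG(m, q)`, by removing the fixed point `p` of an automorphism `σ` that is a
      -- cycle on the other points, together with the blocks through `p`, which are one `σ`-orbit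
      ∃ (F : Type) (_ : Field F), Nat.card F = q ∧
        ∃ (σ : Equiv.Perm (Fin m → F)) (p : Fin m → F),
          CyclicPacking.IsIsomorphism
            (CyclicPacking.affineLines m F) (CyclicPacking.affineLines m F) σ ∧
          σ p = p ∧
          (∃ L ∈ CyclicPacking.affineLines m F,
            {c | c ∈ CyclicPacking.affineLines m F ∧ p ∈ c} = CyclicPacking.blockOrbit σ L) ∧
          ∃ τ : ZMod (q ^ m - 1) ≃ {x : Fin m → F // x ≠ p},
            (∀ i, ((τ (i + 1) : {x : Fin m → F // x ≠ p}) : Fin m → F) = σ (τ i)) ∧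
            CyclicPacking.IsIsomorphism B
              (CyclicPacking.deletePoint (CyclicPacking.affineLines m F) p) τ := by
  open CyclicPacking in
  obtain ⟨r, n, hr, hn, rfl⟩ := (isPrimePow_nat_iff q).1 hq
  have : Fact r.Prime := ⟨hr⟩
  have : NeZero m := ⟨by omega⟩
  let F := GaloisField r n
  let E := FiniteField.Extension F r m
  have hFcard : Nat.card F = r ^ n := GaloisField.card r n hn.ne'
  have hEcard : Nat.card E = (r ^ n) ^ m := by rw [FiniteField.natCard_extension, hFcard]
  have : Finite E := Module.finite_of_finite F
  let e : E ≃ₗ[F] (Fin m → F) := LinearEquiv.ofFinrankEq _ _ (by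
    rw [FiniteField.finrank_extension, Module.finrank_fin_fun])
  obtain ⟨g, φ, hφ, hg⟩ := exists_equiv_zmod_of_isCyclic Eˣ (n := (r ^ n) ^ m - 1)
    (by rw [Nat.card_units, hEcard])
  let τ := φ.trans (unitsEquivNeZero e)
  let ι : ZMod ((r ^ n) ^ m - 1) → (Fin m → F) := fun i => τ i
  have hι : Function.Injective ι := Subtype.val_injective.comp τ.injective
  have hrange : Set.range ι = {0}ᶜ := by
    change Set.range (Subtype.val ∘ τ) = _
    rw [Set.range_comp, τ.range_eq_univ, Set.image_univ]
    exact Subtype.range_val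
  have hstep : ∀ i, ι (i + 1) = unitsPerm e g (ι i) := by
    intro i
    change e (φ (i + 1)) = unitsPerm e g (e (φ i))
    rw [hφ, unitsPerm_apply, e.symm_apply_apply, Units.val_mul]
  have hP : Nat.card (ZMod ((r ^ n) ^ m - 1)) = (r ^ n) ^ m - 1 := Nat.card_zmod _
  have : Finite (ZMod ((r ^ n) ^ m - 1)) := Finite.of_equiv _ φ.symm
  refine ⟨puncturedLines F ι, ?_, fun b hb => ?_, ?_, F, inferInstance, hFcard, unitsPerm e g, 0,
    ?_, unitsPerm_zero e g, ⟨Set.range fun t : F => 0 + t • e 1, ?_, ?_⟩, τ, hstep, ?_⟩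
  · have := isMaximumPacking_puncturedLines (F := F) hι hrange
    rwa [hP, hFcard] at this
  · have : ι '' ((fun x => x + 1) '' b) = unitsPerm e g '' (ι '' b) := by
      rw [← Set.image_comp, ← Set.image_comp]
      exact Set.image_congr fun i _ => hstep i
    rw [puncturedLines, Set.mem_ofPred_eq, this]
    exact IsLine.image_unitsPerm hb e g
  · have := isEvenFree_puncturedLines (F := F) (hFcard ▸ hodd) (by rwa [Module.finrank_fin_fun]) hι
    rwa [hFcard] at this
  · refine Set.ext fun c => ⟨?_, fun hc => ⟨(unitsPerm e g).symm '' c, ?_, ?_⟩⟩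
    · rintro ⟨b, hb, rfl⟩
      rw [mem_affineLines_iff] at hb ⊢
      exact hb.image_unitsPerm e g
    · rw [mem_affineLines_iff] at hc ⊢
      rw [← isLine_image_unitsPerm_iff e g]
      simpa using hc
    · simp
  · exact mem_affineLines_iff.2 ⟨0, e 1, by simp, rfl⟩
  · rw [← setOf_isLine_zero_mem_eq_blockOrbit e hg]
    simp only [mem_affineLines_iff]
  · have himage : ∀ b, Subtype.val '' (τ '' b) = ι '' b := fun b => (Set.image_comp _ _ _).symm
    refine Set.ext fun c => ⟨?_, fun hc => ⟨τ.symm '' c, ?_, ?_⟩⟩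
    · rintro ⟨b, hb, rfl⟩
      change Subtype.val '' (τ '' b) ∈ affineLines m F
      rw [himage, mem_affineLines_iff]
      exact hb
    · change IsLine F (ι '' _)
      rw [← himage, Equiv.image_symm_image, ← mem_affineLines_iff]
      exact hc
    · simp
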